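/- Let $\Omega\subset\mathbb C$ be a simply connected domain with non-empty boundary, let $\mathbb D$ be the open unit disc, $\mu$ the Lebesgue measure, and let $\varphi:\Omega\to\mathbb D$ be a conformal homeomorphism (a holomorphic bijection) with conformal weight $h(z)=J(z,\varphi)=|\varphi'(z)|^2$. Let $\alpha_0\in(-2,0)$, and suppose that the Inverse Brennan Conjecture holds for $\Omega$ on $[\alpha_0,2/3)$, that is, $$\int_{\mathbb D}|\psi'(w)|^{\alpha}\,d\mu(w)<\infty$$ for every conformal homeomorphism $\psi:\mathbb D\to\Omega$ and every $\alpha\in[\alpha_0,2/3)$. Let $p\in\Big(\frac{|\alpha_0|+2}{|\alpha_0|+1},\,2\Big)$. Let $W^1_p(\Omega)$ be the space of weakly differentiable functions $f:\Omega\to\mathbb R$ with finite norm $\big(\int_\Omega|f|^p\,d\mu\big)^{1/p}+\big(\int_\Omega|\nabla f|^p\,d\mu\big)^{1/p}$, let $\overset{\circ}{W}{}^1_p(\Omega)$ be the closure of $C_0^\infty(\Omega)$ in $W^1_p(\Omega)$, and let $L_r(\Omega,h)$ be the space of functions $f:\Omega\to\mathbb R$ with norm $\big(\int_\Omega|f|^r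 h\,d\mu\big)^{1/r}<\infty$ (functions equal almost everywhere being identified). Then $\frac{2p}{2-p}\cdot\frac{|\alpha_0|}{2+|\alpha_0|}<\frac{p}{2-p}$, and for every real $r$ with $$1\le r<\frac{2p}{2-p}\cdot\frac{|\alpha_0|}{2+|\alpha_0|}$$ one has $\overset{\circ}{W}{}^1_p(\Omega)\subset L_r(\Omega,h)$, and the embedding operator $j_r:\overset{\circ}{W}{}^1_p(\Omega)\to L_r(\Omega,h)$, $f\mapsto f$, is a compact (bounded linear) operator. -/

import Mathlib

open MeasureTheory Set Metric
open scoped ENNReal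

noncomputable section

namespace ConformalEmbedding

/-- `φ` is a conformal homeomorphism of the plane open set `U` onto the plane open set `V`:
a holomorphic bijection (its inverse is then automatically holomorphic). Only the values of `φ`
on `U` matter. -/
structure IsConformalHomeo (φ : ℂ → ℂ) (U V : Set ℂ) : Prop where
  differentiableOn : DifferentiableOn ℂ φ U
  bijOn : BijOn φ U V

/-- The inverse Brennan estimate for the domain `Ω` and the set `I` of exponents:
`∫_𝔻 |ψ'(w)|^α dμ < ∞` for all conformal homeomorphisms `ψ : 𝔻 → Ω` and all `α ∈ I`. -/
def InverseBrennan (Ω : Set ℂ) (I : Set ℝ) : Prop :=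
  ∀ ψ : ℂ → ℂ, IsConformalHomeo ψ (ball 0 1) Ω →
    ∀ α ∈ I, ∫⁻ w in ball (0 : ℂ) 1, ‖deriv ψ w‖ₑ ^ α < ∞

/-- `η ∈ C₀^∞(Ω)`: a smooth real function whose support is a compact subset of `Ω`. -/
structure IsTestFunction (Ω : Set ℂ) (η : ℂ → ℝ) : Prop where
  contDiff : ContDiff ℝ (⊤ : ℕ∞) η
  hasCompactSupport : HasCompactSupport η
  tsupport_subset : tsupport η ⊆ Ω

/-- The classical gradient `(∂η/∂x, ∂η/∂y)`, with `ℝ²` identified with `ℂ`. -/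
def grad (η : ℂ → ℝ) (z : ℂ) : ℂ := ⟨fderiv ℝ η z 1, fderiv ℝ η z Complex.I⟩

/-- `g = (g₁, g₂)` (written as the complex function `g₁ + i g₂`) is the weak gradient of `f`
in `Ω`. -/
def IsWeakGradient (Ω : Set ℂ) (f : ℂ → ℝ) (g : ℂ → ℂ) : Prop :=
  ∀ η : ℂ → ℝ, IsTestFunction Ω η →
    (∫ z in Ω, f z * (grad η z).re = - ∫ z in Ω, (g z).re * η z) ∧
    (∫ z in Ω, f z * (grad η z).im = - ∫ z in Ω, (g z).im * η z)

instance fact_one_le_ofReal {p : ℝ} [h : Fact (1 ≤ p)] : Fact (1 ≤ ENNReal.ofReal p) :=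
  ⟨ENNReal.one_le_ofReal.2 h.out⟩

/-- The unweighted Lebesgue space `L_p(Ω; F)`. -/
abbrev LpOn (Ω : Set ℂ) (F : Type) [NormedAddCommGroup F] (p : ℝ) : Type :=
  Lp F (ENNReal.ofReal p) (volume.restrict Ω)

/-- Pairs `(f, g) ∈ L_p(Ω; ℝ) × L_p(Ω; ℝ²)` with the norm `‖f‖_{L_p} + ‖g‖_{L_p}`. -/
abbrev LpPair (Ω : Set ℂ) (p : ℝ) : Type :=
  WithLp 1 (LpOn Ω ℝ p × LpOn Ω ℂ p)

theorem integrable_mul {Ω : Set ℂ} {p : ℝ} [hp : Fact (1 ≤ p)]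
    (f : LpOn Ω ℝ p) {η : ℂ → ℝ} (h1 : Continuous η) (h2 : HasCompactSupport η) :
    Integrable (fun z => f z * η z) (volume.restrict Ω) := by
  have h := ((Lp.memLp f).locallyIntegrable fact_one_le_ofReal.out)
  exact h.integrable_smul_right_of_hasCompactSupport h1 h2

theorem integrable_mul_re {Ω : Set ℂ} {p : ℝ} [hp : Fact (1 ≤ p)]
    (g : LpOn Ω ℂ p) {η : ℂ → ℝ} (h1 : Continuous η) (h2 : HasCompactSupport η) :
    Integrable (fun z => (g z).re * η z) (volume.restrict Ω) := by
  have h := ((Lp.memLp g).re.locallyIntegrable fact_one_le_ofReal.out)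
  exact h.integrable_smul_right_of_hasCompactSupport h1 h2

theorem integrable_mul_im {Ω : Set ℂ} {p : ℝ} [hp : Fact (1 ≤ p)]
    (g : LpOn Ω ℂ p) {η : ℂ → ℝ} (h1 : Continuous η) (h2 : HasCompactSupport η) :
    Integrable (fun z => (g z).im * η z) (volume.restrict Ω) := by
  have h := ((Lp.memLp g).im.locallyIntegrable fact_one_le_ofReal.out)
  exact h.integrable_smul_right_of_hasCompactSupport h1 h2

theorem IsTestFunction.continuous_fderiv_apply {Ω : Set ℂ} {η : ℂ → ℝ}
    (h : IsTestFunction Ω η) (v : ℂ) : Continuous fun z => fderiv ℝ η z v :=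
  (h.contDiff.continuous_fderiv (by simp)).clm_apply continuous_const

theorem IsTestFunction.hasCompactSupport_fderiv_apply {Ω : Set ℂ} {η : ℂ → ℝ}
    (h : IsTestFunction Ω η) (v : ℂ) : HasCompactSupport fun z => fderiv ℝ η z v :=
  h.hasCompactSupport.fderiv_apply ℝ v

/-- The Sobolev space `W^1_p(Ω)` of weakly differentiable `f : Ω → ℝ`, with the norm
`‖f‖_{L_p(Ω)} + ‖∇f‖_{L_p(Ω)}`. A function `f` (modulo equality almost everywhere) is recorded
together with its weak gradient, which is determined by `f` since `Ω` is open. -/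
def SobolevW (Ω : Set ℂ) (p : ℝ) [Fact (1 ≤ p)] : Submodule ℝ (LpPair Ω p) where
  carrier := {u | IsWeakGradient Ω u.fst u.snd}
  zero_mem' := by
    intro η _
    have e1 := Lp.coeFn_zero ℝ (ENNReal.ofReal p) (volume.restrict Ω)
    have e2 := Lp.coeFn_zero ℂ (ENNReal.ofReal p) (volume.restrict Ω)
    constructor
    · rw [integral_eq_zero_of_ae, integral_eq_zero_of_ae, neg_zero]
      · filter_upwards [e2] with z hz
        simp only [WithLp.zero_snd, hz, Pi.zero_apply, Complex.zero_re, zero_mul]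
      · filter_upwards [e1] with z hz
        simp only [WithLp.zero_fst, hz, Pi.zero_apply, zero_mul]
    · rw [integral_eq_zero_of_ae, integral_eq_zero_of_ae, neg_zero]
      · filter_upwards [e2] with z hz
        simp only [WithLp.zero_snd, hz, Pi.zero_apply, Complex.zero_im, zero_mul]
      · filter_upwards [e1] with z hz
        simp only [WithLp.zero_fst, hz, Pi.zero_apply, zero_mul]
  add_mem' := by
    intro u v hu hv η hη
    have e1 := Lp.coeFn_add u.fst v.fst
    have e2 := Lp.coeFn_add u.snd v.snd
    have hc := hη.contDiff.continuous
    have hs := hη.hasCompactSupport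
    have d := hη.continuous_fderiv_apply
    have s := hη.hasCompactSupport_fderiv_apply
    constructor
    · calc ∫ z in Ω, (u + v).fst z * (grad η z).re
          = ∫ z in Ω, (u.fst z * (grad η z).re + v.fst z * (grad η z).re) := by
            apply integral_congr_ae
            filter_upwards [e1] with z hz
            simp only [WithLp.add_fst, hz, Pi.add_apply, add_mul]
        _ = - ((∫ z in Ω, (u.snd z).re * η z) + ∫ z in Ω, (v.snd z).re * η z) := by
            rw [neg_add, ← (hu η hη).1, ← (hv η hη).1]
            exact integral_add (integrable_mul _ (d 1) (s 1))
              (integrable_mul _ (d 1) (s 1))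
        _ = - ∫ z in Ω, ((u + v).snd z).re * η z := by
            rw [← integral_add (integrable_mul_re _ hc hs)
              (integrable_mul_re _ hc hs)]
            congr 1
            apply integral_congr_ae
            filter_upwards [e2] with z hz
            simp only [WithLp.add_snd, hz, Pi.add_apply, Complex.add_re, add_mul]
    · calc ∫ z in Ω, (u + v).fst z * (grad η z).im
          = ∫ z in Ω, (u.fst z * (grad η z).im + v.fst z * (grad η z).im) := by
            apply integral_congr_ae
            filter_upwards [e1] with z hz
            simp only [WithLp.add_fst, hz, Pi.add_apply, add_mul]
        _ = - ((∫ z in Ω, (u.snd z).im * η z) + ∫ z in Ω, (v.snd z).im * η z) := by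
            rw [neg_add, ← (hu η hη).2, ← (hv η hη).2]
            exact integral_add (integrable_mul _ (d Complex.I) (s Complex.I))
              (integrable_mul _ (d Complex.I) (s Complex.I))
        _ = - ∫ z in Ω, ((u + v).snd z).im * η z := by
            rw [← integral_add (integrable_mul_im _ hc hs)
              (integrable_mul_im _ hc hs)]
            congr 1
            apply integral_congr_ae
            filter_upwards [e2] with z hz
            simp only [WithLp.add_snd, hz, Pi.add_apply, Complex.add_im, add_mul]
  smul_mem' := by
    intro c u hu η hη
    have e1 := Lp.coeFn_smul c u.fst
    have e2 := Lp.coeFn_smul c u.snd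
    constructor
    · calc ∫ z in Ω, (c • u).fst z * (grad η z).re
          = ∫ z in Ω, c * (u.fst z * (grad η z).re) := by
            apply integral_congr_ae
            filter_upwards [e1] with z hz
            simp only [WithLp.smul_fst, hz, Pi.smul_apply, smul_eq_mul, mul_assoc]
        _ = - (c * ∫ z in Ω, (u.snd z).re * η z) := by
            rw [integral_const_mul, (hu η hη).1, mul_neg]
        _ = - ∫ z in Ω, ((c • u).snd z).re * η z := by
            rw [← integral_const_mul]
            congr 1
            apply integral_congr_ae
            filter_upwards [e2] with z hz
            simp only [WithLp.smul_snd, hz, Pi.smul_apply, Complex.smul_re, smul_eq_mul, mul_assoc]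
    · calc ∫ z in Ω, (c • u).fst z * (grad η z).im
          = ∫ z in Ω, c * (u.fst z * (grad η z).im) := by
            apply integral_congr_ae
            filter_upwards [e1] with z hz
            simp only [WithLp.smul_fst, hz, Pi.smul_apply, smul_eq_mul, mul_assoc]
        _ = - (c * ∫ z in Ω, (u.snd z).im * η z) := by
            rw [integral_const_mul, (hu η hη).2, mul_neg]
        _ = - ∫ z in Ω, ((c • u).snd z).im * η z := by
            rw [← integral_const_mul]
            congr 1
            apply integral_congr_ae
            filter_upwards [e2] with z hz
            simp only [WithLp.smul_snd, hz, Pi.smul_apply, Complex.smul_im, smul_eq_mul, mul_assoc]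

/-- The elements of `W^1_p(Ω)` represented by functions of class `C₀^∞(Ω)`. -/
def testElements (Ω : Set ℂ) (p : ℝ) [Fact (1 ≤ p)] : Set (SobolevW Ω p) :=
  {u | ∃ η : ℂ → ℝ, IsTestFunction Ω η ∧ u.1.fst =ᵐ[volume.restrict Ω] η}

/-- `W̊^1_p(Ω)`: the closure of `C₀^∞(Ω)` in the norm of `W^1_p(Ω)`. (The set `testElements` is
a linear subspace, so that its span adds nothing.) -/
def SobolevW0 (Ω : Set ℂ) (p : ℝ) [Fact (1 ≤ p)] : Submodule ℝ (SobolevW Ω p) :=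
  (Submodule.span ℝ (testElements Ω p)).topologicalClosure

/-- The measure `v dμ` on `Ω` defined by a nonnegative weight `v`. -/
def weightMeasure (Ω : Set ℂ) (v : ℂ → ℝ) : Measure ℂ :=
  (volume.restrict Ω).withDensity fun z => ENNReal.ofReal (v z)

/-- The weighted Lebesgue space `L_r(Ω, v)`. -/
abbrev WeightedLp (Ω : Set ℂ) (v : ℂ → ℝ) (r : ℝ) : Type :=
  Lp ℝ (ENNReal.ofReal r) (weightMeasure Ω v)

/-- The conformal weight `h(z) = J(z, φ) = |φ'(z)|²`. -/
def conformalWeight (φ : ℂ → ℂ) (z : ℂ) : ℝ := ‖deriv φ z‖ ^ 2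

/-- `j` is the embedding operator `W̊^1_p(Ω) → L_r(Ω, v)`, `f ↦ f`. Equality is almost everywhere
in `Ω` with respect to Lebesgue measure. -/
def IsEmbeddingOperator (Ω : Set ℂ) (v : ℂ → ℝ) (p r : ℝ) [Fact (1 ≤ p)] [Fact (1 ≤ r)]
    (j : SobolevW0 Ω p →L[ℝ] WeightedLp Ω v r) : Prop :=
  ∀ f : SobolevW0 Ω p, (j f : ℂ → ℝ) =ᵐ[volume.restrict Ω] (f.1.1.fst : ℂ → ℝ)

end ConformalEmbedding

end

noncomputable section

namespace ConformalEmbedding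

open Filter Topology

/-! The problem is moved to the unit disc. Put `ψ = φ⁻¹` and send a test function `η` on `Ω` to `η ∘
ψ`, extended by zero. The weight `h` is the Jacobian of `φ`, so the `L_r(Ω, h)` norm of `η` equals
the unweighted `L_r` norm of `η ∘ ψ` on the disc (`eLpNorm_weightMeasure`).

Gradients lose integrability under this transfer. For `q < p`, Hölder's inequality bounds `‖∇(η ∘
ψ)‖_q` by `‖∇η‖_p` times a power of `∫ |ψ'|^α`, where `α = -q(2-p)/(p-q)`
(`eLpNorm_fderiv_transplant_le`). With `q = |α₀| p / (2 + |α₀| - p)` this `α` is exactly `α₀`, where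
the inverse Brennan estimate is available, and the Sobolev exponent `2q/(2-q)` is exactly the stated
bound for `r`.

On the disc, `C¹` functions supported inside it with bounded gradients in `L_q` are totally bounded
in `L_r` for `r < 2q/(2-q)` (`exists_finite_net_eLpNorm`). This follows from total boundedness in
`L¹` and interpolation with the Sobolev inequality. Density of test functions and Fatou's lemma
extend the norm bound to the whole space, and density with continuity of the operator extends
compactness (`exists_compact_embeddingOperator`). -/

/-! ### Conformal homeomorphisms: regularity of the inverse and change of variables. -/

theorem not_eventually_const_of_injOn {φ : ℂ → ℂ} {U : Set ℂ} (hU : IsOpen U)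
    (hφ : InjOn φ U) {z : ℂ} (hz : z ∈ U) : ¬ ∀ᶠ x in 𝓝 z, φ x = φ z := by
  intro h
  have h1 : ∀ᶠ x in 𝓝[≠] z, x = z := by
    filter_upwards [h.filter_mono nhdsWithin_le_nhds,
      (hU.eventually_mem hz).filter_mono nhdsWithin_le_nhds] with x hx hxU
    exact hφ hxU hz hx
  obtain ⟨x, hx, hx'⟩ := (h1.and self_mem_nhdsWithin).exists
  exact hx' hx

/-- The inverse of a conformal homeomorphism. -/
def conformalInverse (φ : ℂ → ℂ) (U : Set ℂ) : ℂ → ℂ := Function.invFunOn φ U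

namespace IsConformalHomeo

variable {φ : ℂ → ℂ} {U V : Set ℂ}

theorem inverse_mapsTo (h : IsConformalHomeo φ U V) : MapsTo (conformalInverse φ U) V U :=
  h.bijOn.surjOn.mapsTo_invFunOn

theorem right_inv (h : IsConformalHomeo φ U V) {w : ℂ} (hw : w ∈ V) :
    φ (conformalInverse φ U w) = w :=
  h.bijOn.surjOn.rightInvOn_invFunOn hw

theorem left_inv (h : IsConformalHomeo φ U V) {z : ℂ} (hz : z ∈ U) :
    conformalInverse φ U (φ z) = z :=
  h.bijOn.injOn.leftInvOn_invFunOn hz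

theorem inverse_bijOn (h : IsConformalHomeo φ U V) : BijOn (conformalInverse φ U) V U :=
  (h.bijOn.invOn_invFunOn.symm).bijOn h.inverse_mapsTo h.bijOn.mapsTo

theorem analyticAt (h : IsConformalHomeo φ U V) (hU : IsOpen U) {z : ℂ} (hz : z ∈ U) :
    AnalyticAt ℂ φ z :=
  h.differentiableOn.analyticAt (hU.mem_nhds hz)

/-- By the open mapping theorem, `φ` sends neighbourhoods of a point to neighbourhoods of its image,
because an injective function is not locally constant. -/
theorem inverse_continuousAt (h : IsConformalHomeo φ U V) (hU : IsOpen U) {w : ℂ} (hw : w ∈ V) :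
    ContinuousAt (conformalInverse φ U) w := by
  have hz := h.inverse_mapsTo hw
  have h1 := (h.analyticAt hU hz).eventually_constant_or_nhds_le_map_nhds.resolve_left
    (not_eventually_const_of_injOn hU h.bijOn.injOn hz)
  rw [h.right_inv hw] at h1
  refine Tendsto.mono_left ?_ h1
  refine tendsto_map'_iff.2 (tendsto_id.congr' ?_)
  filter_upwards [hU.mem_nhds hz] with x hx
  exact (h.left_inv hx).symm

theorem inverse_differentiableAt_of_deriv_ne_zero (h : IsConformalHomeo φ U V) (hU : IsOpen U)
    (hV : IsOpen V) {w : ℂ} (hw : w ∈ V) (h0 : deriv φ (conformalInverse φ U w) ≠ 0) :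
    DifferentiableAt ℂ (conformalInverse φ U) w := by
  have hz := h.inverse_mapsTo hw
  refine (HasDerivAt.of_local_left_inverse (h.inverse_continuousAt hU hw)
    (h.analyticAt hU hz).differentiableAt.hasDerivAt h0 ?_).differentiableAt
  filter_upwards [hV.mem_nhds hw] with x hx
  exact h.right_inv hx

/-- The zeros of the analytic function `φ'` are isolated unless it vanishes near `z`, which would
make `φ` locally constant. -/
theorem eventually_deriv_ne_zero (h : IsConformalHomeo φ U V) (hU : IsOpen U) {z : ℂ}
    (hz : z ∈ U) : ∀ᶠ x in 𝓝[≠] z, deriv φ x ≠ 0 := by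
  refine (h.analyticAt hU hz).deriv.eventually_eq_zero_or_eventually_ne_zero.resolve_left ?_
  intro h0
  obtain ⟨ε, hε, hb⟩ := Metric.eventually_nhds_iff_ball.1
    (h0.and (hU.eventually_mem hz))
  refine not_eventually_const_of_injOn hU h.bijOn.injOn hz ?_
  filter_upwards [ball_mem_nhds z hε] with x hx
  exact isOpen_ball.is_const_of_deriv_eq_zero (convex_ball z ε).isPreconnected
    (h.differentiableOn.mono fun y hy => (hb y hy).2) (fun y hy => (hb y hy).1) hx
    (mem_ball_self hε)

/-- Critical points of `φ` are not excluded in advance. They are isolated, so the inverse is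
continuous at `w` and holomorphic in a punctured neighbourhood, and the singularity is removable.
That `φ'` has no zeros is then a consequence of the chain rule. -/
theorem inverse_differentiableAt (h : IsConformalHomeo φ U V) (hU : IsOpen U)
    (hV : IsOpen V) {w : ℂ} (hw : w ∈ V) :
    DifferentiableAt ℂ (conformalInverse φ U) w := by
  have hc := h.inverse_continuousAt hU hw
  refine (Complex.analyticAt_of_differentiable_on_punctured_nhds_of_continuousAt ?_
    hc).differentiableAt
  have hV' : ∀ᶠ x in 𝓝[≠] w, x ∈ V :=
    (hV.eventually_mem hw).filter_mono nhdsWithin_le_nhds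
  have ht : Tendsto (conformalInverse φ U) (𝓝[≠] w) (𝓝[≠] (conformalInverse φ U w)) := by
    refine tendsto_nhdsWithin_iff.2 ⟨hc.tendsto.mono_left nhdsWithin_le_nhds, ?_⟩
    filter_upwards [hV', self_mem_nhdsWithin] with x hx hxw
    exact fun e => hxw (h.inverse_bijOn.injOn hx hw e)
  filter_upwards [hV', ht.eventually (h.eventually_deriv_ne_zero hU (h.inverse_mapsTo hw))]
    with x hx hx'
  exact h.inverse_differentiableAt_of_deriv_ne_zero hU hV hx hx'

/-- The inverse of a conformal homeomorphism is a conformal homeomorphism. -/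
theorem inverse (h : IsConformalHomeo φ U V) (hU : IsOpen U) (hV : IsOpen V) :
    IsConformalHomeo (conformalInverse φ U) V U :=
  ⟨fun _ hw => (h.inverse_differentiableAt hU hV hw).differentiableWithinAt, h.inverse_bijOn⟩

theorem deriv_ne_zero (h : IsConformalHomeo φ U V) (hU : IsOpen U) (hV : IsOpen V) {z : ℂ}
    (hz : z ∈ U) : deriv φ z ≠ 0 := by
  have hw := h.bijOn.mapsTo hz
  have h1 : HasDerivAt (conformalInverse φ U ∘ φ)
      (deriv (conformalInverse φ U) (φ z) * deriv φ z) z :=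
    (h.inverse_differentiableAt hU hV hw).hasDerivAt.comp z
      (h.analyticAt hU hz).differentiableAt.hasDerivAt
  have h2 : HasDerivAt (conformalInverse φ U ∘ φ) 1 z := by
    refine (hasDerivAt_id z).congr_of_eventuallyEq ?_
    filter_upwards [hU.mem_nhds hz] with x hx
    exact h.left_inv hx
  intro h0
  rw [h0, mul_zero] at h1
  exact zero_ne_one (h1.unique h2)

/-- Change of variables under a conformal homeomorphism. -/
theorem lintegral_comp (h : IsConformalHomeo φ U V) (hU : IsOpen U) (g : ℂ → ℝ≥0∞) :
    ∫⁻ w in V, g w = ∫⁻ z in U, ENNReal.ofReal (‖deriv φ z‖ ^ 2) * g (φ z) := by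
  have hd : ∀ z ∈ U, HasFDerivWithinAt φ
      ((ContinuousLinearMap.toSpanSingleton ℂ (deriv φ z)).restrictScalars ℝ) U z := fun z hz =>
    ((h.analyticAt hU hz).differentiableAt.hasDerivAt.hasFDerivAt.restrictScalars
      ℝ).hasFDerivWithinAt
  rw [← h.bijOn.image_eq, lintegral_image_eq_lintegral_abs_det_fderiv_mul volume hU.measurableSet
    hd h.bijOn.injOn]
  refine setLIntegral_congr_fun hU.measurableSet fun z _ => ?_
  -- The real determinant of a complex-linear map is the norm from `ℂ` to `ℝ` of its complex
  -- determinant.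
  have hdet : ((ContinuousLinearMap.toSpanSingleton ℂ (deriv φ z)).restrictScalars ℝ).det =
      ‖deriv φ z‖ ^ 2 := by
    simp [ContinuousLinearMap.det, LinearMap.det_restrictScalars, Algebra.norm_complex_apply,
      Complex.normSq_eq_norm_sq]
  simp only [hdet, abs_of_nonneg (sq_nonneg ‖deriv φ z‖)]

end IsConformalHomeo

/-! ### Rellich–Kondrachov in the unit disc. -/

/-- Integrate the derivative along the segment from `x` to `x + h`, then use Tonelli and translation
invariance. -/
theorem lintegral_enorm_translate_sub_le {u : ℂ → ℝ} (hu : ContDiff ℝ 1 u) (h : ℂ) :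
    ∫⁻ x, ‖u (x + h) - u x‖ₑ ≤ ‖h‖ₑ * ∫⁻ x, ‖fderiv ℝ u x‖ₑ := by
  have hc : Continuous (fderiv ℝ u) := hu.continuous_fderiv one_ne_zero
  have hpt : ∀ x, ‖u (x + h) - u x‖ₑ ≤
      ∫⁻ t in Ioc (0 : ℝ) 1, ‖h‖ₑ * ‖fderiv ℝ u (x + t • h)‖ₑ := by
    intro x
    have hd : ∀ t ∈ uIcc (0 : ℝ) 1,
        HasDerivAt (fun t : ℝ => u (x + t • h)) (fderiv ℝ u (x + t • h) h) t := by
      intro t _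
      have h1 : HasDerivAt (fun t : ℝ => x + t • h) h t := by
        simpa using ((hasDerivAt_id t).smul_const h).const_add x
      exact ((hu.differentiable one_ne_zero) _).hasFDerivAt.comp_hasDerivAt t h1
    have hcont : Continuous fun t : ℝ => fderiv ℝ u (x + t • h) h := by fun_prop
    have hint := intervalIntegral.integral_eq_sub_of_hasDerivAt hd (hcont.intervalIntegrable _ _)
    simp only [one_smul, zero_smul, add_zero] at hint
    rw [← hint, intervalIntegral.integral_of_le zero_le_one]
    refine (enorm_integral_le_lintegral_enorm _).trans (lintegral_mono fun t => ?_)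
    rw [mul_comm]
    exact ContinuousLinearMap.le_opENorm _ _
  calc ∫⁻ x, ‖u (x + h) - u x‖ₑ
      ≤ ∫⁻ x, ∫⁻ t in Ioc (0 : ℝ) 1, ‖h‖ₑ * ‖fderiv ℝ u (x + t • h)‖ₑ := lintegral_mono hpt
    _ = ∫⁻ t in Ioc (0 : ℝ) 1, ∫⁻ x, ‖h‖ₑ * ‖fderiv ℝ u (x + t • h)‖ₑ := by
        refine lintegral_lintegral_swap (Continuous.aemeasurable ?_)
        refine ENNReal.continuous_const_mul enorm_ne_top |>.comp ?_
        exact continuous_enorm.comp (hc.comp (by fun_prop))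
    _ = ∫⁻ t in Ioc (0 : ℝ) 1, ‖h‖ₑ * ∫⁻ x, ‖fderiv ℝ u x‖ₑ := by
        refine lintegral_congr fun t => ?_
        rw [lintegral_const_mul' _ _ enorm_ne_top]
        congr 1
        exact lintegral_add_right_eq_self (fun x => ‖fderiv ℝ u x‖ₑ) (t • h)
    _ = ‖h‖ₑ * ∫⁻ x, ‖fderiv ℝ u x‖ₑ := by simp

/-- A function whose averages over a fine net of discs are small is small in `L¹` of the unit
disc, up to its variation. -/
theorem lintegral_enorm_le_of_net {u : ℂ → ℝ} (hu : ContDiff ℝ 1 u) {ε m : ℝ} (hε : 0 < ε)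
    {T : Set ℂ} (hT : ball (0 : ℂ) 1 ⊆ ⋃ y ∈ T, ball y ε)
    (hm : ∀ y ∈ T, ‖∫ z in ball y ε, u z‖ ≤ ε ^ 2 * m) :
    ∫⁻ x in ball (0 : ℂ) 1, ‖u x‖ₑ ≤
      ENNReal.ofReal (8 * ε) * (∫⁻ x, ‖fderiv ℝ u x‖ₑ) + ENNReal.ofReal m := by
  have hc := hu.continuous
  -- Compare `u x` with the average of `u` over a net disc `ball y ε` containing `x`. This disc lies
  -- in `ball x (2 * ε)`, so the error is controlled by translates of length less than `2ε`.
  have hpt : ∀ x ∈ ball (0 : ℂ) 1, volume (ball (0 : ℂ) ε) * ‖u x‖ₑ ≤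
      (∫⁻ h in ball (0 : ℂ) (2 * ε), ‖u (x + h) - u x‖ₑ) + ENNReal.ofReal (ε ^ 2 * m) := by
    intro x hx
    obtain ⟨y, hy, hxy⟩ := mem_iUnion₂.1 (hT hx)
    have hi : IntegrableOn u (ball y ε) :=
      (hc.continuousOn.integrableOn_compact (isCompact_closedBall y ε)).mono_set
        ball_subset_closedBall
    have hi' : IntegrableOn (fun _ : ℂ => u x) (ball y ε) :=
      integrableOn_const measure_ball_lt_top.ne
    have e : ∫ _ in ball y ε, u x = (∫ z in ball y ε, (u x - u z)) + ∫ z in ball y ε, u z := by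
      rw [integral_sub hi' hi, sub_add_cancel]
    have hvol : volume (ball (0 : ℂ) ε) = volume (ball y ε) := by
      simp [Complex.volume_ball]
    calc volume (ball (0 : ℂ) ε) * ‖u x‖ₑ = ‖∫ _ in ball y ε, u x‖ₑ := by
          rw [setIntegral_const, enorm_smul, hvol, Real.enorm_eq_ofReal measureReal_nonneg,
            ofReal_measureReal measure_ball_lt_top.ne]
      _ ≤ ‖∫ z in ball y ε, (u x - u z)‖ₑ + ‖∫ z in ball y ε, u z‖ₑ := by
          rw [e]; exact enorm_add_le _ _
      _ ≤ (∫⁻ z in ball y ε, ‖u x - u z‖ₑ) + ENNReal.ofReal (ε ^ 2 * m) := by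
          refine add_le_add (enorm_integral_le_lintegral_enorm _) ?_
          rw [← ofReal_norm]
          exact ENNReal.ofReal_le_ofReal (hm y hy)
      _ ≤ _ := by
          gcongr ?_ + _
          calc ∫⁻ z in ball y ε, ‖u x - u z‖ₑ
              ≤ ∫⁻ z in ball x (2 * ε), ‖u x - u z‖ₑ := by
                refine lintegral_mono_set (ball_subset_ball' ?_)
                rw [mem_ball'] at hxy
                linarith
            _ = ∫⁻ z, (ball x (2 * ε)).indicator (fun z => ‖u x - u z‖ₑ) z :=
                (lintegral_indicator measurableSet_ball _).symm
            _ = ∫⁻ h, (ball x (2 * ε)).indicator (fun z => ‖u x - u z‖ₑ) (h + x) :=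
                (lintegral_add_right_eq_self _ x).symm
            _ = ∫⁻ h, (ball (0 : ℂ) (2 * ε)).indicator (fun h => ‖u (x + h) - u x‖ₑ) h := by
                refine lintegral_congr fun h => ?_
                simp only [indicator, mem_ball, dist_eq_norm, add_sub_cancel_right, sub_zero]
                rw [add_comm h x, ← enorm_neg, neg_sub]
            _ = _ := lintegral_indicator measurableSet_ball _
  have h0 : volume (ball (0 : ℂ) ε) ≠ 0 := (measure_ball_pos _ _ hε).ne'
  have htop : volume (ball (0 : ℂ) ε) ≠ ∞ := measure_ball_lt_top.ne
  rw [← ENNReal.mul_le_mul_iff_right h0 htop]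
  calc volume (ball (0 : ℂ) ε) * ∫⁻ x in ball (0 : ℂ) 1, ‖u x‖ₑ
      = ∫⁻ x in ball (0 : ℂ) 1, volume (ball (0 : ℂ) ε) * ‖u x‖ₑ :=
        (lintegral_const_mul' _ _ htop).symm
    _ ≤ ∫⁻ x in ball (0 : ℂ) 1, ((∫⁻ h in ball (0 : ℂ) (2 * ε), ‖u (x + h) - u x‖ₑ) +
          ENNReal.ofReal (ε ^ 2 * m)) := setLIntegral_mono' measurableSet_ball hpt
    _ = (∫⁻ x in ball (0 : ℂ) 1, ∫⁻ h in ball (0 : ℂ) (2 * ε), ‖u (x + h) - u x‖ₑ) +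
          ENNReal.ofReal (ε ^ 2 * m) * volume (ball (0 : ℂ) 1) := by
        rw [lintegral_add_right _ measurable_const, setLIntegral_const]
    _ ≤ (∫⁻ _ in ball (0 : ℂ) (2 * ε), ENNReal.ofReal (2 * ε) * ∫⁻ x, ‖fderiv ℝ u x‖ₑ) +
          ENNReal.ofReal (ε ^ 2 * m) * volume (ball (0 : ℂ) 1) := by
        gcongr ?_ + _
        rw [lintegral_lintegral_swap (Continuous.aemeasurable (by fun_prop))]
        refine setLIntegral_mono' measurableSet_ball fun h hh => ?_
        refine (setLIntegral_le_lintegral _ _).trans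
          ((lintegral_enorm_translate_sub_le hu h).trans ?_)
        gcongr
        rw [← ofReal_norm]
        exact ENNReal.ofReal_le_ofReal (mem_ball_zero_iff.1 hh).le
    -- The disc of radius `2ε` has four times the area of that of radius `ε`, and `4 · 2ε = 8ε`. The
    -- normalisation `ε² m` turns `ε² m π` into `m` times the area `π ε²`.
    _ = volume (ball (0 : ℂ) ε) *
          (ENNReal.ofReal (8 * ε) * (∫⁻ x, ‖fderiv ℝ u x‖ₑ) + ENNReal.ofReal m) := by
        rw [setLIntegral_const, Complex.volume_ball, Complex.volume_ball, Complex.volume_ball,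
          ENNReal.ofReal_mul (sq_nonneg ε), ENNReal.ofReal_pow hε.le,
          ENNReal.ofReal_mul zero_le_two, ENNReal.ofReal_mul (by norm_num : (0 : ℝ) ≤ 8),
          ENNReal.ofReal_one,
          show ENNReal.ofReal 8 = 8 by norm_num, show ENNReal.ofReal 2 = 2 by norm_num]
        ring

/-- A family of `C¹` functions supported in the unit disc, bounded in `W^1_1`, is totally
bounded in `L¹`. -/
theorem exists_finite_net_lintegral_enorm {ι : Type*} {G : ι → ℂ → ℝ}
    (hG : ∀ i, ContDiff ℝ 1 (G i)) (hs : ∀ i, tsupport (G i) ⊆ ball 0 1) {C C' : ℝ}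
    (hC : ∀ i, ∫⁻ x, ‖fderiv ℝ (G i) x‖ₑ ≤ ENNReal.ofReal C)
    (hC' : ∀ i, ∫⁻ x, ‖G i x‖ₑ ≤ ENNReal.ofReal C') (hC0 : 0 ≤ C) {δ : ℝ} (hδ : 0 < δ) :
    ∃ t : Set ι, t.Finite ∧ ∀ i, ∃ k ∈ t, ∫⁻ x, ‖G i x - G k x‖ₑ ≤ ENNReal.ofReal δ := by
  have hC1 : 0 < C + 1 := by linarith
  -- The gradient of a difference has `L¹` norm at most `2 * C`. Its contribution is to use half of
  -- `δ`, the averages the other half.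
  obtain ⟨ε, hε, hεC⟩ : ∃ ε : ℝ, 0 < ε ∧ 8 * ε * (2 * C) ≤ δ / 2 := by
    refine ⟨δ / (32 * (C + 1)), by positivity, ?_⟩
    have : 8 * (δ / (32 * (C + 1))) * (2 * C) = δ / 2 * (C / (C + 1)) := by
      field_simp; ring
    rw [this]
    exact mul_le_of_le_one_right (by positivity) ((div_le_one hC1).2 (by linarith))
  obtain ⟨T, -, hTf, hT⟩ := finite_approx_of_totallyBounded
    ((isCompact_closedBall (0 : ℂ) 1).totallyBounded.subset ball_subset_closedBall) ε hε
  have : Fintype T := hTf.fintype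
  have hint : ∀ i, Integrable (G i) := fun i =>
    (hG i).continuous.integrable_of_hasCompactSupport
      (HasCompactSupport.of_support_subset_isCompact (isCompact_closedBall (0 : ℂ) 1)
        ((subset_tsupport _).trans ((hs i).trans ball_subset_closedBall)))
  -- Each function is recorded by finitely many integrals. These vectors form a bounded set in a
  -- finite-dimensional space, which is therefore totally bounded.
  set A : ι → T → ℝ := fun i y => ∫ z in ball (y : ℂ) ε, G i z with hA
  have hAb : TotallyBounded (range A) := by
    have hb : Bornology.IsBounded (range A) := by
      refine isBounded_iff_forall_norm_le.2 ⟨max C' 0, ?_⟩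
      rintro _ ⟨i, rfl⟩
      refine (pi_norm_le_iff_of_nonneg (le_max_right _ _)).2 fun y => ?_
      have h1 : ‖A i y‖ₑ ≤ ENNReal.ofReal C' :=
        (enorm_integral_le_lintegral_enorm _).trans
          ((setLIntegral_le_lintegral _ _).trans (hC' i))
      rw [← ofReal_norm] at h1
      rcases le_or_gt 0 C' with h0 | h0
      · exact ((ENNReal.ofReal_le_ofReal_iff h0).1 h1).trans (le_max_left _ _)
      · rw [ENNReal.ofReal_of_nonpos h0.le, nonpos_iff_eq_zero, ENNReal.ofReal_eq_zero] at h1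
        exact h1.trans (le_max_right _ _)
    exact hb.isCompact_closure.totallyBounded.subset subset_closure
  obtain ⟨S, hSA, hSf, hS⟩ := finite_approx_of_totallyBounded hAb (ε ^ 2 * (δ / 2))
    (by positivity)
  rw [← image_univ] at hSA
  obtain ⟨t, -, htf, rfl⟩ := exists_subset_image_finite_and.1 ⟨S, hSA, hSf, rfl⟩
  refine ⟨t, htf, fun i => ?_⟩
  obtain ⟨_, ⟨k, hk, rfl⟩, hik⟩ := mem_iUnion₂.1 (hS (mem_range_self i))
  refine ⟨k, hk, ?_⟩
  have hd : ∀ x, fderiv ℝ (fun x => G i x - G k x) x = fderiv ℝ (G i) x - fderiv ℝ (G k) x :=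
    fun x => fderiv_fun_sub ((hG i).differentiable one_ne_zero x)
      ((hG k).differentiable one_ne_zero x)
  have hm : ∀ y ∈ T, ‖∫ z in ball y ε, (G i z - G k z)‖ ≤ ε ^ 2 * (δ / 2) := by
    intro y hy
    rw [integral_sub (hint i).integrableOn (hint k).integrableOn]
    have := (dist_le_pi_dist (A i) (A k) ⟨y, hy⟩).trans (mem_ball.1 hik).le
    rwa [dist_eq_norm] at this
  have hD : ∫⁻ x, ‖fderiv ℝ (fun x => G i x - G k x) x‖ₑ ≤ ENNReal.ofReal (2 * C) := by
    calc ∫⁻ x, ‖fderiv ℝ (fun x => G i x - G k x) x‖ₑ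
        ≤ ∫⁻ x, (‖fderiv ℝ (G i) x‖ₑ + ‖fderiv ℝ (G k) x‖ₑ) := by
          refine lintegral_mono fun x => ?_
          rw [hd]
          exact enorm_sub_le
      _ = (∫⁻ x, ‖fderiv ℝ (G i) x‖ₑ) + ∫⁻ x, ‖fderiv ℝ (G k) x‖ₑ :=
          lintegral_add_left ((hG i).continuous_fderiv one_ne_zero).enorm.measurable _
      _ ≤ ENNReal.ofReal C + ENNReal.ofReal C := add_le_add (hC i) (hC k)
      _ = ENNReal.ofReal (2 * C) := by rw [two_mul, ENNReal.ofReal_add hC0 hC0]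
  have hsupp : Function.support (fun x => ‖G i x - G k x‖ₑ) ⊆ ball (0 : ℂ) 1 := by
    intro x hx
    by_contra hxb
    have h1 : G i x = 0 := image_eq_zero_of_notMem_tsupport fun h => hxb (hs i h)
    have h2 : G k x = 0 := image_eq_zero_of_notMem_tsupport fun h => hxb (hs k h)
    simp [h1, h2] at hx
  rw [← setLIntegral_eq_of_support_subset hsupp]
  refine (lintegral_enorm_le_of_net ((hG i).sub (hG k)) hε hT hm).trans ?_
  calc ENNReal.ofReal (8 * ε) * (∫⁻ x, ‖fderiv ℝ (fun x => G i x - G k x) x‖ₑ) +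
        ENNReal.ofReal (δ / 2)
      ≤ ENNReal.ofReal (8 * ε) * ENNReal.ofReal (2 * C) + ENNReal.ofReal (δ / 2) := by gcongr
    _ = ENNReal.ofReal (8 * ε * (2 * C) + δ / 2) := by
        rw [← ENNReal.ofReal_mul (by positivity), ENNReal.ofReal_add (by positivity)
          (by positivity)]
    _ ≤ ENNReal.ofReal δ := ENNReal.ofReal_le_ofReal (by linarith)

/-- Log-convexity of the `L^r` norms, between `L¹` and `L^s`. -/
theorem lintegral_rpow_le_interpolation {X : Type*} [MeasurableSpace X] {μ : Measure X}
    {f : X → ℝ≥0∞} (hf : AEMeasurable f μ) {r s : ℝ} (hr : 1 ≤ r) (hrs : r < s) :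
    ∫⁻ x, f x ^ r ∂μ ≤
      (∫⁻ x, f x ∂μ) ^ ((s - r) / (s - 1)) * (∫⁻ x, f x ^ s ∂μ) ^ ((r - 1) / (s - 1)) := by
  have hs : 0 < s - 1 := by linarith
  have h1 : 0 ≤ (s - r) / (s - 1) := div_nonneg (by linarith) hs.le
  have h2 : 0 ≤ (r - 1) / (s - 1) := div_nonneg (by linarith) hs.le
  -- Hölder for `f ^ r = f ^ a * (f ^ s) ^ b`, where `a = (s - r) / (s - 1)` and `b = (r - 1) / (s -
  -- 1)` satisfy `a + b = 1` and `a + s b = r`.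
  refine le_trans (le_of_eq ?_) (ENNReal.lintegral_mul_norm_pow_le hf (hf.pow_const s) h1 h2
    (by field_simp; ring))
  refine lintegral_congr fun x => ?_
  rw [← ENNReal.rpow_mul, ← ENNReal.rpow_add_of_nonneg _ _ h1
    (mul_nonneg (by linarith) h2)]
  congr 1
  field_simp
  ring

/-- The Sobolev inequality in the unit disc. -/
theorem exists_sobolev_const {q : ℝ} (hq : 1 ≤ q) (hq2 : q < 2) {s : ℝ} (hs : 0 < s)
    (hsq : s ≤ 2 * q / (2 - q)) :
    ∃ K : ℝ, 0 ≤ K ∧ ∀ u : ℂ → ℝ, ContDiff ℝ 1 u → tsupport u ⊆ ball 0 1 →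
      eLpNorm u (ENNReal.ofReal s) volume ≤
        ENNReal.ofReal K * eLpNorm (fderiv ℝ u) (ENNReal.ofReal q) volume := by
  refine ⟨eLpNormLESNormFDerivOfLeConst ℝ (volume : Measure ℂ) (ball (0 : ℂ) 1) q.toNNReal
    s.toNNReal, NNReal.coe_nonneg _, fun u hu hsu => ?_⟩
  rw [ENNReal.ofReal_coe_nnreal]
  refine eLpNorm_le_eLpNorm_fderiv_of_le volume hu ((subset_tsupport u).trans hsu) ?_ ?_ ?_
    isBounded_ball
  · exact Real.one_le_toNNReal.2 hq
  · rw [Complex.finrank_real_complex]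
    exact (Real.toNNReal_lt_iff_lt_coe (by linarith)).2 (by simpa using hq2)
  · rw [Complex.finrank_real_complex, Real.coe_toNNReal _ hs.le, NNReal.coe_inv,
      Real.coe_toNNReal _ (by linarith)]
    have h2 : 0 < 2 - q := by linarith
    have : q⁻¹ - ((2 : ℕ) : ℝ)⁻¹ = (2 * q / (2 - q))⁻¹ := by
      have : q ≠ 0 := by linarith
      push_cast
      field_simp
    rw [this]
    exact inv_anti₀ hs hsq

/-- The Rellich–Kondrachov theorem for `C¹` functions supported in the unit disc. -/
theorem exists_finite_net_eLpNorm {ι : Type*} {G : ι → ℂ → ℝ} {q r : ℝ} (hq : 1 ≤ q)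
    (hq2 : q < 2) (hr : 1 ≤ r) (hrq : r < 2 * q / (2 - q))
    (hG : ∀ i, ContDiff ℝ 1 (G i)) (hs : ∀ i, tsupport (G i) ⊆ ball 0 1) {C : ℝ} (hC0 : 0 ≤ C)
    (hC : ∀ i, eLpNorm (fderiv ℝ (G i)) (ENNReal.ofReal q) volume ≤ ENNReal.ofReal C)
    {δ : ℝ} (hδ : 0 < δ) :
    ∃ t : Set ι, t.Finite ∧ ∀ i, ∃ k ∈ t,
      eLpNorm (G i - G k) (ENNReal.ofReal r) volume ≤ ENNReal.ofReal δ := by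
  set s := 2 * q / (2 - q) with hsdef
  have hs1 : 0 < s - 1 := by linarith
  have hspos : 0 < s := by linarith
  have hrpos : 0 < r := by linarith
  obtain ⟨K₁, hK₁, h1⟩ := exists_sobolev_const hq hq2 one_pos (by linarith : 1 ≤ 2 * q / (2 - q))
  obtain ⟨K, hK, hS⟩ := exists_sobolev_const hq hq2 hspos le_rfl
  have hfd : ∀ i, Function.support (fun x => ‖fderiv ℝ (G i) x‖ₑ) ⊆ ball (0 : ℂ) 1 := by
    intro i x hx
    by_contra hxb
    have : fderiv ℝ (G i) x = 0 := by
      have := image_eq_zero_of_notMem_tsupport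
        (fun h => hxb (hs i ((tsupport_fderiv_subset ℝ) h)) : x ∉ tsupport (fderiv ℝ (G i)))
      exact this
    exact hx (by simp only [this, ← ofReal_norm, norm_zero, ENNReal.ofReal_zero])
  -- Hölder on the disc, whose area is `π`.
  have hbound1 : ∀ i, ∫⁻ x, ‖fderiv ℝ (G i) x‖ₑ ≤
      ENNReal.ofReal (C * (Real.pi) ^ (1 - 1 / q)) := by
    intro i
    rw [← setLIntegral_eq_of_support_subset (hfd i), ← eLpNorm_one_eq_lintegral_enorm]
    refine (eLpNorm_le_eLpNorm_mul_rpow_measure_univ (q := ENNReal.ofReal q)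
      (ENNReal.one_le_ofReal.2 hq)
      ((hG i).continuous_fderiv one_ne_zero).aestronglyMeasurable).trans ?_
    rw [ENNReal.ofReal_mul hC0, ← ENNReal.ofReal_rpow_of_pos Real.pi_pos,
      Measure.restrict_apply_univ, Complex.volume_ball,
      ENNReal.toReal_ofReal (by linarith : (0 : ℝ) ≤ q)]
    refine mul_le_mul' ((eLpNorm_mono_measure _ Measure.restrict_le_self).trans (hC i))
      (le_of_eq ?_)
    simp [ENNReal.ofReal, Real.toNNReal_of_nonneg Real.pi_nonneg]
    rfl
  have hbound2 : ∀ i, ∫⁻ x, ‖G i x‖ₑ ≤ ENNReal.ofReal (K₁ * C) := by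
    intro i
    rw [← eLpNorm_one_eq_lintegral_enorm, ENNReal.ofReal_mul hK₁, ← ENNReal.ofReal_one]
    exact (h1 _ (hG i) (hs i)).trans (mul_le_mul_right (hC i) _)
  have hbounds : ∀ i k, ∫⁻ x, ‖G i x - G k x‖ₑ ^ s ≤ ENNReal.ofReal ((2 * (K * C)) ^ s) := by
    intro i k
    have hs0 : ENNReal.ofReal s ≠ 0 := by simpa using hspos
    have h2 : eLpNorm (G i - G k) (ENNReal.ofReal s) volume ≤ ENNReal.ofReal (2 * (K * C)) := by
      refine (eLpNorm_sub_le (hG i).continuous.aestronglyMeasurable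
        (hG k).continuous.aestronglyMeasurable (ENNReal.one_le_ofReal.2 (by linarith))).trans ?_
      rw [two_mul, ENNReal.ofReal_add (by positivity) (by positivity), ENNReal.ofReal_mul hK]
      exact add_le_add ((hS _ (hG i) (hs i)).trans (mul_le_mul_right (hC i) _))
        ((hS _ (hG k) (hs k)).trans (mul_le_mul_right (hC k) _))
    rw [eLpNorm_eq_lintegral_rpow_enorm_toReal hs0 ENNReal.ofReal_ne_top,
      ENNReal.toReal_ofReal hspos.le, one_div] at h2
    rw [← ENNReal.ofReal_rpow_of_nonneg (by positivity) hspos.le]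
    exact (ENNReal.rpow_inv_le_iff hspos).1 h2
  set a := (s - r) / (s - 1) with ha
  have hapos : 0 < a := div_pos (by linarith) hs1
  have hb : 0 ≤ (r - 1) / (s - 1) := div_nonneg (by linarith) hs1.le
  set M := ((2 * (K * C)) ^ s) ^ ((r - 1) / (s - 1)) with hM
  have hM0 : 0 ≤ M := by positivity
  -- `η` is the `L¹` precision for which interpolation with the uniform `L^s` bound gives precision
  -- `δ` in `L^r`. This needs `a > 0`, that is, `r < s`.
  obtain ⟨η, hη, hηM⟩ : ∃ η : ℝ, 0 < η ∧ η ^ a * M ≤ δ ^ r := by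
    refine ⟨(δ ^ r / (M + 1)) ^ a⁻¹, by positivity, ?_⟩
    rw [← Real.rpow_mul (by positivity), inv_mul_cancel₀ hapos.ne', Real.rpow_one,
      div_mul_eq_mul_div, div_le_iff₀ (by positivity)]
    have : 0 < δ ^ r := by positivity
    nlinarith
  obtain ⟨t, htf, ht⟩ := exists_finite_net_lintegral_enorm hG hs hbound1 hbound2
    (by positivity) hη
  refine ⟨t, htf, fun i => ?_⟩
  obtain ⟨k, hk, hik⟩ := ht i
  refine ⟨k, hk, ?_⟩
  rw [eLpNorm_eq_lintegral_rpow_enorm_toReal (by simpa using hrpos) ENNReal.ofReal_ne_top,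
    ENNReal.toReal_ofReal hrpos.le, one_div, ENNReal.rpow_inv_le_iff hrpos]
  have hmeas : AEMeasurable (fun x => ‖G i x - G k x‖ₑ) volume :=
    ((hG i).continuous.sub (hG k).continuous).enorm.aemeasurable
  calc ∫⁻ x, ‖(G i - G k) x‖ₑ ^ r
      ≤ (∫⁻ x, ‖G i x - G k x‖ₑ) ^ a *
          (∫⁻ x, ‖G i x - G k x‖ₑ ^ s) ^ ((r - 1) / (s - 1)) :=
        lintegral_rpow_le_interpolation hmeas hr hrq
    _ ≤ ENNReal.ofReal η ^ a * ENNReal.ofReal ((2 * (K * C)) ^ s) ^ ((r - 1) / (s - 1)) := by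
        gcongr
        exact hbounds i k
    _ = ENNReal.ofReal (η ^ a * M) := by
        rw [ENNReal.ofReal_mul (by positivity), ENNReal.ofReal_rpow_of_pos hη,
          ENNReal.ofReal_rpow_of_nonneg (by positivity) hb]
    _ ≤ ENNReal.ofReal (δ ^ r) := ENNReal.ofReal_le_ofReal hηM
    _ = ENNReal.ofReal δ ^ r := (ENNReal.ofReal_rpow_of_pos hδ).symm

/-! ### Transplanting test functions by a conformal homeomorphism. -/

/-- The function `η ∘ φ⁻¹` on `V`, extended by zero, where `φ : U → V`. -/
def transplant (φ : ℂ → ℂ) (U V : Set ℂ) (η : ℂ → ℝ) : ℂ → ℝ :=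
  V.indicator (η ∘ conformalInverse φ U)

theorem transplant_sub (φ : ℂ → ℂ) (U V : Set ℂ) (η ζ : ℂ → ℝ) :
    transplant φ U V (η - ζ) = transplant φ U V η - transplant φ U V ζ :=
  indicator_sub V (η ∘ conformalInverse φ U) (ζ ∘ conformalInverse φ U)

namespace IsConformalHomeo

variable {φ : ℂ → ℂ} {U V : Set ℂ}

theorem transplant_apply (h : IsConformalHomeo φ U V) (η : ℂ → ℝ) {z : ℂ} (hz : z ∈ U) :
    transplant φ U V η (φ z) = η z := by
  rw [transplant, indicator_of_mem (h.bijOn.mapsTo hz), Function.comp_apply, h.left_inv hz]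

/-- The image under `φ` of the compact support of `η` is compact, hence closed in `ℂ`. The extension
by zero is therefore harmless at the boundary of `V`. -/
theorem tsupport_transplant_subset (h : IsConformalHomeo φ U V) {η : ℂ → ℝ}
    (hη : IsTestFunction U η) : tsupport (transplant φ U V η) ⊆ V := by
  have hK : IsCompact (φ '' tsupport η) := hη.hasCompactSupport.isCompact.image_of_continuousOn
    (h.differentiableOn.continuousOn.mono hη.tsupport_subset)
  have hKV : φ '' tsupport η ⊆ V :=
    (image_mono hη.tsupport_subset).trans h.bijOn.image_eq.subset
  refine (closure_minimal (fun w hw => ?_) hK.isClosed).trans hKV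
  have hwV : w ∈ V := by
    by_contra hwV
    exact hw (indicator_of_notMem hwV _)
  rw [Function.mem_support, transplant, indicator_of_mem hwV] at hw
  exact ⟨_, subset_tsupport _ hw, h.right_inv hwV⟩

theorem transplant_eventuallyEq (hV : IsOpen V) (η : ℂ → ℝ) {w : ℂ} (hw : w ∈ V) :
    transplant φ U V η =ᶠ[𝓝 w] η ∘ conformalInverse φ U := by
  filter_upwards [hV.mem_nhds hw] with x hx
  exact indicator_of_mem hx _

theorem contDiff_transplant (h : IsConformalHomeo φ U V) (hU : IsOpen U) (hV : IsOpen V)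
    {η : ℂ → ℝ} (hη : IsTestFunction U η) : ContDiff ℝ 1 (transplant φ U V η) := by
  refine contDiff_iff_contDiffAt.2 fun w => ?_
  by_cases hw : w ∈ tsupport (transplant φ U V η)
  swap
  · exact contDiffAt_const.congr_of_eventuallyEq (notMem_tsupport_iff_eventuallyEq.1 hw)
  have hwV := h.tsupport_transplant_subset hη hw
  refine ContDiffAt.congr_of_eventuallyEq ?_ (transplant_eventuallyEq hV η hwV)
  have h1 : ContDiffAt ℝ 1 (conformalInverse φ U) w :=
    (((h.inverse hU hV).differentiableOn.contDiffOn hV).contDiffAt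
      (hV.mem_nhds hwV)).restrict_scalars ℝ
  exact (hη.contDiff.of_le (by simp)).contDiffAt.comp w h1

theorem enorm_fderiv_transplant_le (h : IsConformalHomeo φ U V) (hU : IsOpen U) (hV : IsOpen V)
    {η : ℂ → ℝ} (hη : IsTestFunction U η) {w : ℂ} (hw : w ∈ V) :
    ‖fderiv ℝ (transplant φ U V η) w‖ₑ ≤
      ‖fderiv ℝ η (conformalInverse φ U w)‖ₑ * ‖deriv (conformalInverse φ U) w‖ₑ := by
  have h1 : HasFDerivAt (conformalInverse φ U)
      ((ContinuousLinearMap.toSpanSingleton ℂ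
        (deriv (conformalInverse φ U) w)).restrictScalars ℝ) w :=
    (h.inverse_differentiableAt hU hV hw).hasDerivAt.hasFDerivAt.restrictScalars ℝ
  have h2 := ((hη.contDiff.differentiable (by simp)) (conformalInverse φ U w)).hasFDerivAt.comp w h1
  rw [(transplant_eventuallyEq hV η hw).fderiv_eq, h2.fderiv, ← ofReal_norm, ← ofReal_norm,
    ← ofReal_norm, ← ENNReal.ofReal_mul (norm_nonneg _)]
  refine ENNReal.ofReal_le_ofReal ((ContinuousLinearMap.opNorm_comp_le _ _).trans ?_)
  rw [ContinuousLinearMap.norm_restrictScalars, ContinuousLinearMap.norm_toSpanSingleton]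

theorem support_enorm_fderiv_transplant_subset (h : IsConformalHomeo φ U V)
    {η : ℂ → ℝ} (hη : IsTestFunction U η) :
    Function.support (fun w => ‖fderiv ℝ (transplant φ U V η) w‖ₑ) ⊆ V := by
  intro w hw
  refine h.tsupport_transplant_subset hη (tsupport_fderiv_subset ℝ (subset_tsupport _ ?_))
  intro h0
  exact hw (by simp only [h0, ← ofReal_norm, norm_zero, ENNReal.ofReal_zero])

/-- The composition operator of `φ⁻¹` is bounded from the Dirichlet `p`-seminorm to the Dirichlet
`q`-seminorm, when `φ⁻¹` has an integrable derivative with the exponent `-q (2 - p) / (p - q)`. -/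
theorem eLpNorm_fderiv_transplant_le (h : IsConformalHomeo φ U V) (hU : IsOpen U) (hV : IsOpen V)
    {p q : ℝ} (hq : 0 < q) (hqp : q < p) {η : ℂ → ℝ} (hη : IsTestFunction U η) :
    eLpNorm (fderiv ℝ (transplant φ U V η)) (ENNReal.ofReal q) volume ≤
      (∫⁻ w in V, ‖deriv (conformalInverse φ U) w‖ₑ ^ (-(q * (2 - p) / (p - q)))) ^
          ((p - q) / p * q⁻¹) *
        eLpNorm (fderiv ℝ η) (ENNReal.ofReal p) (volume.restrict U) := by
  have hp : 0 < p := hq.trans hqp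
  have hψ := h.inverse hU hV
  set ψ := conformalInverse φ U with hψdef
  set α := -(q * (2 - p) / (p - q)) with hα
  set A : ℂ → ℝ≥0∞ := fun z => ‖fderiv ℝ η z‖ₑ with hA
  have hAc : Continuous A := (hη.contDiff.continuous_fderiv (by simp)).enorm
  have hAψ : AEMeasurable (fun w => A (ψ w)) (volume.restrict V) :=
    (hAc.comp_continuousOn hψ.differentiableOn.continuousOn).aemeasurable hV.measurableSet
  have hD : AEMeasurable (fun w => ‖deriv ψ w‖ₑ) (volume.restrict V) :=
    (measurable_deriv ψ).enorm.aemeasurable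
  have hpq : 0 < p - q := sub_pos.2 hqp
  have main : ∫⁻ w, ‖fderiv ℝ (transplant φ U V η) w‖ₑ ^ q ≤
      (∫⁻ z in U, A z ^ p) ^ (q / p) * (∫⁻ w in V, ‖deriv ψ w‖ₑ ^ α) ^ ((p - q) / p) := by
    have hsupp : Function.support (fun w => ‖fderiv ℝ (transplant φ U V η) w‖ₑ ^ q) ⊆ V := by
      intro w hw
      refine h.support_enorm_fderiv_transplant_subset hη fun h0 => hw ?_
      simp only at h0 ⊢
      rw [h0, ENNReal.zero_rpow_of_pos hq]
    rw [← setLIntegral_eq_of_support_subset hsupp]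
    -- Hölder with weights `q / p` and `(p - q) / p`. One factor carries the Jacobian `|ψ'|²`; the
    -- exponent `α` of the other is forced by `2q/p + α(p - q)/p = q`.
    calc ∫⁻ w in V, ‖fderiv ℝ (transplant φ U V η) w‖ₑ ^ q
        ≤ ∫⁻ w in V, (A (ψ w) ^ p * ‖deriv ψ w‖ₑ ^ (2 : ℝ)) ^ (q / p) *
            (‖deriv ψ w‖ₑ ^ α) ^ ((p - q) / p) := by
          refine setLIntegral_mono_ae' hV.measurableSet (Eventually.of_forall fun w hw => ?_)
          have hd0 : ‖deriv ψ w‖ₑ ≠ 0 := enorm_ne_zero.2 (hψ.deriv_ne_zero hV hU hw)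
          refine (ENNReal.rpow_le_rpow (h.enorm_fderiv_transplant_le hU hV hη hw) hq.le).trans
            (le_of_eq ?_)
          rw [ENNReal.mul_rpow_of_nonneg _ _ hq.le,
            ENNReal.mul_rpow_of_nonneg _ _ (by positivity), ← ENNReal.rpow_mul,
            ← ENNReal.rpow_mul, ← ENNReal.rpow_mul, mul_assoc, ← ENNReal.rpow_add _ _ hd0
            enorm_ne_top, mul_div_cancel₀ _ hp.ne']
          congr 2
          rw [hα]
          field_simp
          ring
      _ ≤ (∫⁻ w in V, A (ψ w) ^ p * ‖deriv ψ w‖ₑ ^ (2 : ℝ)) ^ (q / p) *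
            (∫⁻ w in V, ‖deriv ψ w‖ₑ ^ α) ^ ((p - q) / p) :=
          ENNReal.lintegral_mul_norm_pow_le ((hAψ.pow_const p).mul (hD.pow_const 2))
            (hD.pow_const α) (by positivity) (by positivity) (by field_simp; ring)
      _ = _ := by
          congr 2
          rw [hψ.lintegral_comp hV (fun z => A z ^ p)]
          refine lintegral_congr fun w => ?_
          rw [ENNReal.ofReal_pow (norm_nonneg _), ofReal_norm, mul_comm, ENNReal.rpow_two]
  rw [eLpNorm_eq_lintegral_rpow_enorm_toReal (by simpa using hq) ENNReal.ofReal_ne_top,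
    eLpNorm_eq_lintegral_rpow_enorm_toReal (by simpa using hp) ENNReal.ofReal_ne_top,
    ENNReal.toReal_ofReal hq.le, ENNReal.toReal_ofReal hp.le, one_div]
  refine (ENNReal.rpow_le_rpow main (by positivity)).trans (le_of_eq ?_)
  rw [ENNReal.mul_rpow_of_nonneg _ _ (by positivity), ← ENNReal.rpow_mul, ← ENNReal.rpow_mul,
    mul_comm]
  congr 2
  field_simp

/-- The weight is the Jacobian of `φ`, so this is the change of variables formula. -/
theorem eLpNorm_weightMeasure (h : IsConformalHomeo φ U V) (hU : IsOpen U)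
    {r : ℝ} (hr : 0 < r) {η : ℂ → ℝ} (hη : Measurable η) :
    eLpNorm η (ENNReal.ofReal r) (weightMeasure U (conformalWeight φ)) =
      eLpNorm (transplant φ U V η) (ENNReal.ofReal r) volume := by
  rw [eLpNorm_eq_lintegral_rpow_enorm_toReal (by simpa using hr) ENNReal.ofReal_ne_top,
    eLpNorm_eq_lintegral_rpow_enorm_toReal (by simpa using hr) ENNReal.ofReal_ne_top,
    ENNReal.toReal_ofReal hr.le]
  congr 1
  have hsupp : Function.support (fun w => ‖transplant φ U V η w‖ₑ ^ r) ⊆ V := by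
    intro w hw
    by_contra hwV
    refine hw ?_
    simp only [transplant, indicator_of_notMem hwV, enorm_zero, ENNReal.zero_rpow_of_pos hr]
  have hm : Measurable fun z => ENNReal.ofReal (conformalWeight φ z) :=
    ((measurable_deriv φ).norm.pow_const 2).ennreal_ofReal
  rw [← setLIntegral_eq_of_support_subset hsupp, h.lintegral_comp hU, weightMeasure,
    lintegral_withDensity_eq_lintegral_mul _ hm (hη.enorm.pow_const r)]
  refine setLIntegral_congr_fun hU.measurableSet fun z hz => ?_
  simp only [Pi.mul_apply, conformalWeight, h.transplant_apply η hz]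

theorem restrict_absolutelyContinuous_weightMeasure (h : IsConformalHomeo φ U V) (hU : IsOpen U)
    (hV : IsOpen V) : volume.restrict U ≪ weightMeasure U (conformalWeight φ) := by
  have hm : Measurable fun z => ENNReal.ofReal (conformalWeight φ z) :=
    ((measurable_deriv φ).norm.pow_const 2).ennreal_ofReal
  refine withDensity_absolutelyContinuous' hm.aemeasurable ?_
  filter_upwards [ae_restrict_mem hU.measurableSet] with z hz
  have : 0 < conformalWeight φ z := by
    have := norm_pos_iff.2 (h.deriv_ne_zero hU hV hz)
    unfold conformalWeight
    positivity
  simpa using this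

end IsConformalHomeo

/-! ### Weighted inequalities for test functions on a domain equivalent to the disc. -/

section Disc

variable {φ : ℂ → ℂ} {Ω : Set ℂ} {p q r : ℝ}

/-- The Dirichlet seminorms of transplanted test functions on the disc are bounded. -/
theorem exists_transplant_const (hΩ : IsOpen Ω) (hφ : IsConformalHomeo φ Ω (ball 0 1))
    (hq : 1 ≤ q) (hqp : q < p)
    (hfin : ∫⁻ w in ball (0 : ℂ) 1,
      ‖deriv (conformalInverse φ Ω) w‖ₑ ^ (-(q * (2 - p) / (p - q))) < ∞) :
    ∃ C : ℝ, 0 ≤ C ∧ ∀ η : ℂ → ℝ, IsTestFunction Ω η →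
      eLpNorm (fderiv ℝ (transplant φ Ω (ball 0 1) η)) (ENNReal.ofReal q) volume ≤
        ENNReal.ofReal C * eLpNorm (fderiv ℝ η) (ENNReal.ofReal p) (volume.restrict Ω) := by
  have hq0 : 0 < q := by linarith
  have hpq : 0 < p - q := sub_pos.2 hqp
  have hp : 0 < p := by linarith
  refine ⟨((∫⁻ w in ball (0 : ℂ) 1, ‖deriv (conformalInverse φ Ω) w‖ₑ ^
    (-(q * (2 - p) / (p - q)))) ^ ((p - q) / p * q⁻¹)).toReal, ENNReal.toReal_nonneg,
    fun η hη => ?_⟩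
  rw [ENNReal.ofReal_toReal]
  · exact hφ.eLpNorm_fderiv_transplant_le hΩ isOpen_ball hq0 hqp hη
  · exact ENNReal.rpow_ne_top_of_nonneg (by positivity) hfin.ne

/-- The weighted Sobolev inequality for test functions. -/
theorem exists_weighted_sobolev_const (hΩ : IsOpen Ω) (hφ : IsConformalHomeo φ Ω (ball 0 1))
    (hq : 1 ≤ q) (hqp : q < p) (hq2 : q < 2) (hr : 1 ≤ r) (hrq : r < 2 * q / (2 - q))
    (hfin : ∫⁻ w in ball (0 : ℂ) 1,
      ‖deriv (conformalInverse φ Ω) w‖ₑ ^ (-(q * (2 - p) / (p - q))) < ∞) :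
    ∃ K : ℝ, 0 ≤ K ∧ ∀ η : ℂ → ℝ, IsTestFunction Ω η →
      eLpNorm η (ENNReal.ofReal r) (weightMeasure Ω (conformalWeight φ)) ≤
        ENNReal.ofReal K * eLpNorm (fderiv ℝ η) (ENNReal.ofReal p) (volume.restrict Ω) := by
  obtain ⟨C, hC, hCb⟩ := exists_transplant_const hΩ hφ hq hqp hfin
  obtain ⟨K, hK, hKb⟩ := exists_sobolev_const hq hq2 (by linarith : 0 < r) hrq.le
  refine ⟨K * C, by positivity, fun η hη => ?_⟩
  rw [hφ.eLpNorm_weightMeasure hΩ (by linarith) hη.contDiff.continuous.measurable,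
    ENNReal.ofReal_mul hK, mul_assoc]
  exact (hKb _ (hφ.contDiff_transplant hΩ isOpen_ball hη)
    (hφ.tsupport_transplant_subset hη)).trans (mul_le_mul_right (hCb η hη) _)

/-- Test functions with bounded Dirichlet `p`-seminorms are totally bounded in the weighted
space. -/
theorem exists_finite_net_weighted (hΩ : IsOpen Ω) (hφ : IsConformalHomeo φ Ω (ball 0 1))
    (hq : 1 ≤ q) (hqp : q < p) (hq2 : q < 2) (hr : 1 ≤ r) (hrq : r < 2 * q / (2 - q))
    (hfin : ∫⁻ w in ball (0 : ℂ) 1,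
      ‖deriv (conformalInverse φ Ω) w‖ₑ ^ (-(q * (2 - p) / (p - q))) < ∞)
    {ι : Type*} {η : ι → ℂ → ℝ} (hη : ∀ i, IsTestFunction Ω (η i))
    (hη1 : ∀ i, eLpNorm (fderiv ℝ (η i)) (ENNReal.ofReal p) (volume.restrict Ω) ≤ 1)
    {δ : ℝ} (hδ : 0 < δ) :
    ∃ t : Set ι, t.Finite ∧ ∀ i, ∃ k ∈ t,
      eLpNorm (η i - η k) (ENNReal.ofReal r) (weightMeasure Ω (conformalWeight φ)) ≤
        ENNReal.ofReal δ := by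
  obtain ⟨C, hC, hCb⟩ := exists_transplant_const hΩ hφ hq hqp hfin
  obtain ⟨t, htf, ht⟩ := exists_finite_net_eLpNorm hq hq2 hr hrq
    (fun i => hφ.contDiff_transplant hΩ isOpen_ball (hη i))
    (fun i => hφ.tsupport_transplant_subset (hη i)) hC
    (fun i => (hCb _ (hη i)).trans (mul_le_of_le_one_right' (hη1 i))) hδ
  refine ⟨t, htf, fun i => ?_⟩
  obtain ⟨k, hk, hik⟩ := ht i
  refine ⟨k, hk, ?_⟩
  rwa [hφ.eLpNorm_weightMeasure hΩ (by linarith)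
    ((hη i).contDiff.continuous.sub (hη k).contDiff.continuous).measurable, transplant_sub]

end Disc

/-! ### Test functions and distributions. -/

section TestFunctions

variable {Ω : Set ℂ} {η ζ : ℂ → ℝ}

theorem IsTestFunction.zero : IsTestFunction Ω 0 :=
  ⟨contDiff_const, HasCompactSupport.zero, by simp [tsupport]⟩

theorem IsTestFunction.add (hη : IsTestFunction Ω η) (hζ : IsTestFunction Ω ζ) :
    IsTestFunction Ω (η + ζ) :=
  ⟨hη.contDiff.add hζ.contDiff, hη.hasCompactSupport.add hζ.hasCompactSupport,
    (tsupport_add η ζ).trans (union_subset hη.tsupport_subset hζ.tsupport_subset)⟩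

theorem IsTestFunction.const_smul (hη : IsTestFunction Ω η) (c : ℝ) :
    IsTestFunction Ω (c • η) :=
  ⟨hη.contDiff.const_smul c, hη.hasCompactSupport.mono (Function.support_const_smul_subset c η),
    (closure_mono (Function.support_const_smul_subset c η)).trans hη.tsupport_subset⟩

theorem setIntegral_mul_eq_integral_of_tsupport_subset (f : ℂ → ℝ) (hη : tsupport η ⊆ Ω) :
    ∫ z in Ω, f z * η z = ∫ z, f z * η z :=
  setIntegral_eq_integral_of_forall_compl_eq_zero fun z hz => by
    rw [image_eq_zero_of_notMem_tsupport fun h => hz (hη h), mul_zero]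

theorem IsTestFunction.tsupport_fderiv_apply_subset (hη : IsTestFunction Ω η) (v : ℂ) :
    tsupport (fun z => fderiv ℝ η z v) ⊆ Ω :=
  (_root_.tsupport_fderiv_apply_subset ℝ v).trans hη.tsupport_subset

/-- Integration by parts for test functions. -/
theorem IsTestFunction.integral_mul_fderiv (hη : IsTestFunction Ω η) (hζ : IsTestFunction Ω ζ)
    (v : ℂ) : ∫ z in Ω, η z * fderiv ℝ ζ z v = - ∫ z in Ω, fderiv ℝ η z v * ζ z := by
  rw [setIntegral_mul_eq_integral_of_tsupport_subset _ (hζ.tsupport_fderiv_apply_subset v),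
    setIntegral_mul_eq_integral_of_tsupport_subset _ hζ.tsupport_subset]
  have hc := hη.contDiff.continuous
  have hc' := hζ.contDiff.continuous
  refine integral_mul_fderiv_eq_neg_fderiv_mul_of_integrable ?_ ?_ ?_
    (fun x _ => hη.contDiff.differentiable (by simp) x)
    (fun x _ => hζ.contDiff.differentiable (by simp) x)
  · exact ((hη.continuous_fderiv_apply v).mul hc').integrable_of_hasCompactSupport
      hζ.hasCompactSupport.mul_left
  · exact (hc.mul (hζ.continuous_fderiv_apply v)).integrable_of_hasCompactSupport
      hη.hasCompactSupport.mul_right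
  · exact (hc.mul hc').integrable_of_hasCompactSupport hζ.hasCompactSupport.mul_left

theorem locallyIntegrableOn_of_restrict {f : ℂ → ℝ}
    (hf : LocallyIntegrable f (volume.restrict Ω)) : LocallyIntegrableOn f Ω volume := by
  intro x _
  obtain ⟨s, hs, hi⟩ := hf x
  obtain ⟨o, hos, ho, hxo⟩ := _root_.mem_nhds_iff.1 hs
  refine ⟨o ∩ Ω, inter_mem (mem_nhdsWithin_of_mem_nhds (ho.mem_nhds hxo)) self_mem_nhdsWithin, ?_⟩
  rw [IntegrableOn, ← Measure.restrict_restrict ho.measurableSet]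
  exact hi.mono_set hos

/-- Two locally integrable functions defining the same distribution on `Ω` are equal. -/
theorem ae_eq_of_setIntegral_mul_eq (hΩ : IsOpen Ω) {f g : ℂ → ℝ}
    (hf : LocallyIntegrable f (volume.restrict Ω)) (hg : LocallyIntegrable g (volume.restrict Ω))
    (h : ∀ ζ : ℂ → ℝ, IsTestFunction Ω ζ → ∫ z in Ω, f z * ζ z = ∫ z in Ω, g z * ζ z) :
    f =ᵐ[volume.restrict Ω] g := by
  have key := hΩ.ae_eq_zero_of_integral_contDiff_smul_eq_zero
    (locallyIntegrableOn_of_restrict (hf.sub hg)) fun ζ h1 h2 h3 => by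
      have e := h ζ ⟨h1, h2, h3⟩
      have i1 := hf.integrable_smul_right_of_hasCompactSupport h1.continuous h2
      have i2 := hg.integrable_smul_right_of_hasCompactSupport h1.continuous h2
      calc ∫ z, ζ z • (f - g) z = ∫ z, (f - g) z * ζ z := by simp only [smul_eq_mul, mul_comm]
        _ = ∫ z in Ω, (f - g) z * ζ z :=
          (setIntegral_mul_eq_integral_of_tsupport_subset _ h3).symm
        _ = (∫ z in Ω, f z * ζ z) - ∫ z in Ω, g z * ζ z := by
          simp only [smul_eq_mul] at i1 i2
          rw [← integral_sub i1 i2]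
          simp only [Pi.sub_apply, sub_mul]
        _ = 0 := by rw [e, sub_self]
  filter_upwards [ae_restrict_of_ae key, ae_restrict_mem hΩ.measurableSet] with z hz hzΩ
  exact sub_eq_zero.1 (hz hzΩ)

theorem norm_fderiv_le_norm_grad (η : ℂ → ℝ) (z : ℂ) : ‖fderiv ℝ η z‖ ≤ ‖grad η z‖ := by
  refine ContinuousLinearMap.opNorm_le_bound _ (norm_nonneg _) fun v => ?_
  -- The real inner product of `grad η z` and `v` in complex notation.
  have e : fderiv ℝ η z v = (grad η z * (starRingEnd ℂ) v).re := by
    have hv : v = v.re • (1 : ℂ) + v.im • Complex.I := by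
      apply Complex.ext <;> simp
    conv_lhs => rw [hv]
    rw [map_add, map_smul, map_smul]
    simp [grad]
    ring
  rw [e, Real.norm_eq_abs]
  refine (Complex.abs_re_le_norm _).trans ?_
  rw [norm_mul, Complex.norm_conj]

end TestFunctions

/-! ### From test functions to the closure, and the embedding operator. -/

section Sobolev

variable {Ω : Set ℂ} {p : ℝ} [hp : Fact (1 ≤ p)]

/-- The weak gradient of a test function is its classical gradient. -/
theorem weakGradient_ae_eq_grad (hΩ : IsOpen Ω) (u : SobolevW Ω p) {η : ℂ → ℝ}
    (hη : IsTestFunction Ω η) (hu : u.1.fst =ᵐ[volume.restrict Ω] η) :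
    u.1.snd =ᵐ[volume.restrict Ω] grad η := by
  have hmem := Lp.memLp u.1.snd
  have hloc : ∀ v, LocallyIntegrable (fun z => fderiv ℝ η z v) (volume.restrict Ω) := fun v =>
    (hη.continuous_fderiv_apply v).locallyIntegrable
  have hre : (fun z => (u.1.snd z).re) =ᵐ[volume.restrict Ω] fun z => fderiv ℝ η z 1 := by
    refine ae_eq_of_setIntegral_mul_eq hΩ (hmem.re.locallyIntegrable fact_one_le_ofReal.out)
      (hloc 1) fun ζ hζ => neg_injective ?_
    simp only [← hη.integral_mul_fderiv hζ]
    refine (u.2 ζ hζ).1.symm.trans (integral_congr_ae ?_)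
    filter_upwards [hu] with z hz
    rw [hz, grad]
  have him : (fun z => (u.1.snd z).im) =ᵐ[volume.restrict Ω]
      fun z => fderiv ℝ η z Complex.I := by
    refine ae_eq_of_setIntegral_mul_eq hΩ (hmem.im.locallyIntegrable fact_one_le_ofReal.out)
      (hloc Complex.I) fun ζ hζ => neg_injective ?_
    simp only [← hη.integral_mul_fderiv hζ]
    refine (u.2 ζ hζ).2.symm.trans (integral_congr_ae ?_)
    filter_upwards [hu] with z hz
    rw [hz, grad]
  filter_upwards [hre, him] with z h1 h2
  exact Complex.ext h1 h2

theorem eLpNorm_fderiv_le_norm (hΩ : IsOpen Ω) (u : SobolevW Ω p) {η : ℂ → ℝ}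
    (hη : IsTestFunction Ω η) (hu : u.1.fst =ᵐ[volume.restrict Ω] η) :
    eLpNorm (fderiv ℝ η) (ENNReal.ofReal p) (volume.restrict Ω) ≤ ENNReal.ofReal ‖u‖ := by
  calc eLpNorm (fderiv ℝ η) (ENNReal.ofReal p) (volume.restrict Ω)
      ≤ eLpNorm u.1.snd (ENNReal.ofReal p) (volume.restrict Ω) := by
        refine eLpNorm_mono_ae ?_
        filter_upwards [weakGradient_ae_eq_grad hΩ u hη hu] with z hz
        rw [hz]
        exact norm_fderiv_le_norm_grad η z
    _ = ENNReal.ofReal ‖u.1.snd‖ := by rw [ofReal_norm, Lp.enorm_def]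
    _ ≤ ENNReal.ofReal ‖u‖ := ENNReal.ofReal_le_ofReal (WithLp.norm_snd_le _ u.1)

theorem coe_span_testElements :
    (Submodule.span ℝ (testElements Ω p) : Set (SobolevW Ω p)) = testElements Ω p := by
  refine Subset.antisymm (fun u hu => ?_) Submodule.subset_span
  refine Submodule.span_induction (p := fun u _ => u ∈ testElements Ω p) (fun _ h => h) ?_ ?_ ?_ hu
  · exact ⟨0, .zero, Lp.coeFn_zero _ _ _⟩
  · rintro u v _ _ ⟨η, hη, hu⟩ ⟨ζ, hζ, hv⟩
    exact ⟨η + ζ, hη.add hζ, (Lp.coeFn_add u.1.fst v.1.fst).trans (hu.add hv)⟩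
  · rintro c u _ ⟨η, hη, hu⟩
    exact ⟨c • η, hη.const_smul c, (Lp.coeFn_smul c u.1.fst).trans (hu.const_smul c)⟩

/-- Test functions already form a linear subspace, so the closure of their span is their closure. -/
theorem dense_testElements :
    Dense {f : SobolevW0 Ω p | (f : SobolevW Ω p) ∈ testElements Ω p} := by
  intro f
  have hf : (f : SobolevW Ω p) ∈ closure (testElements Ω p) := by
    rw [← coe_span_testElements, ← Submodule.topologicalClosure_coe]
    exact f.2
  rw [Topology.IsInducing.subtypeVal.closure_eq_preimage_closure_image]
  refine closure_mono (fun u hu => ?_) hf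
  refine ⟨⟨u, Submodule.le_topologicalClosure _ (Submodule.subset_span hu)⟩, hu, rfl⟩

variable {v : ℂ → ℝ} {r K : ℝ}

theorem weightMeasure_absolutelyContinuous (Ω : Set ℂ) (v : ℂ → ℝ) :
    weightMeasure Ω v ≪ volume.restrict Ω :=
  withDensity_absolutelyContinuous _ _

theorem aestronglyMeasurable_weightMeasure (f : SobolevW Ω p) :
    AEStronglyMeasurable f.1.fst (weightMeasure Ω v) :=
  (Lp.aestronglyMeasurable f.1.fst).mono_ac (weightMeasure_absolutelyContinuous Ω v)

/-- A weighted Sobolev inequality for test functions extends to their closure. -/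
theorem eLpNorm_le_of_testFunctions (hΩ : IsOpen Ω)
    (hK : ∀ η : ℂ → ℝ, IsTestFunction Ω η → eLpNorm η (ENNReal.ofReal r) (weightMeasure Ω v) ≤
      ENNReal.ofReal K * eLpNorm (fderiv ℝ η) (ENNReal.ofReal p) (volume.restrict Ω))
    (f : SobolevW0 Ω p) :
    eLpNorm f.1.1.fst (ENNReal.ofReal r) (weightMeasure Ω v) ≤
      ENNReal.ofReal K * ENNReal.ofReal ‖f‖ := by
  obtain ⟨u, hu, hlim⟩ := mem_closure_iff_seq_limit.1 (dense_testElements f)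
  have hfst : Tendsto (fun n => (u n).1.1.fst) atTop (𝓝 f.1.1.fst) := by
    have hc : Continuous fun g : SobolevW0 Ω p => g.1.1.fst :=
      (WithLp.fstL 1 ℝ (LpOn Ω ℝ p) (LpOn Ω ℂ p)).continuous.comp
        (continuous_subtype_val.comp continuous_subtype_val)
    exact (hc.tendsto f).comp hlim
  -- Convergence in `L_p` gives a subsequence converging almost everywhere, also for the weighted
  -- measure. Fatou's lemma then passes the bound to the limit, so the weighted limit is `f` itself.
  obtain ⟨ns, hns, hae⟩ := (tendstoInMeasure_of_tendsto_Lp hfst).exists_seq_tendsto_ae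
  have hbound : ∀ n, eLpNorm (u n).1.1.fst (ENNReal.ofReal r) (weightMeasure Ω v) ≤
      ENNReal.ofReal K * ENNReal.ofReal ‖u n‖ := by
    intro n
    obtain ⟨η, hη, hun⟩ := hu n
    rw [eLpNorm_congr_ae ((weightMeasure_absolutelyContinuous Ω v).ae_eq hun)]
    exact (hK η hη).trans (mul_le_mul_right (eLpNorm_fderiv_le_norm hΩ _ hη hun) _)
  have hlim' : Tendsto (fun n => ENNReal.ofReal K * ENNReal.ofReal ‖u (ns n)‖) atTop
      (𝓝 (ENNReal.ofReal K * ENNReal.ofReal ‖f‖)) :=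
    ENNReal.Tendsto.const_mul (ENNReal.tendsto_ofReal (hlim.norm.comp hns.tendsto_atTop))
      (Or.inr ENNReal.ofReal_ne_top)
  refine (Lp.eLpNorm_lim_le_liminf_eLpNorm
    (fun n => aestronglyMeasurable_weightMeasure (u (ns n)).1) _
    ((weightMeasure_absolutelyContinuous Ω v).ae_le hae)).trans ?_
  rw [← hlim'.liminf_eq]
  exact liminf_le_liminf (Eventually.of_forall fun n => hbound (ns n))

/-- A weighted Sobolev inequality for test functions, together with total boundedness in the
weighted space, gives a compact embedding operator. -/
theorem exists_compact_embeddingOperator [hr : Fact (1 ≤ r)] (hΩ : IsOpen Ω)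
    (hv : volume.restrict Ω ≪ weightMeasure Ω v) (hK0 : 0 ≤ K)
    (hK : ∀ η : ℂ → ℝ, IsTestFunction Ω η → eLpNorm η (ENNReal.ofReal r) (weightMeasure Ω v) ≤
      ENNReal.ofReal K * eLpNorm (fderiv ℝ η) (ENNReal.ofReal p) (volume.restrict Ω))
    (hnet : ∀ {ι : Type} {η : ι → ℂ → ℝ}, (∀ i, IsTestFunction Ω (η i)) →
      (∀ i, eLpNorm (fderiv ℝ (η i)) (ENNReal.ofReal p) (volume.restrict Ω) ≤ 1) →
      ∀ {δ : ℝ}, 0 < δ → ∃ t : Set ι, t.Finite ∧ ∀ i, ∃ k ∈ t,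
        eLpNorm (η i - η k) (ENNReal.ofReal r) (weightMeasure Ω v) ≤ ENNReal.ofReal δ) :
    ∃ j : SobolevW0 Ω p →L[ℝ] WeightedLp Ω v r,
      IsEmbeddingOperator Ω v p r j ∧ IsCompactOperator j := by
  have hac := weightMeasure_absolutelyContinuous Ω v
  have hmem : ∀ f : SobolevW0 Ω p,
      MemLp f.1.1.fst (ENNReal.ofReal r) (weightMeasure Ω v) := fun f =>
    ⟨aestronglyMeasurable_weightMeasure f.1,
      (eLpNorm_le_of_testFunctions hΩ hK f).trans_lt
        (ENNReal.mul_lt_top ENNReal.ofReal_lt_top ENNReal.ofReal_lt_top)⟩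
  let j₀ : SobolevW0 Ω p →ₗ[ℝ] WeightedLp Ω v r :=
    { toFun := fun f => (hmem f).toLp _
      map_add' := fun f g => by
        rw [← MemLp.toLp_add]
        exact MemLp.toLp_congr _ _ (hac.ae_eq (Lp.coeFn_add f.1.1.fst g.1.1.fst))
      map_smul' := fun c f => by
        rw [RingHom.id_apply, ← MemLp.toLp_const_smul]
        exact MemLp.toLp_congr _ _ (hac.ae_eq (Lp.coeFn_smul c f.1.1.fst)) }
  let j : SobolevW0 Ω p →L[ℝ] WeightedLp Ω v r := j₀.mkContinuous K fun f => by
    change ‖(hmem f).toLp _‖ ≤ _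
    rw [Lp.norm_toLp]
    refine ENNReal.toReal_le_of_le_ofReal (by positivity) ?_
    rw [ENNReal.ofReal_mul hK0]
    exact eLpNorm_le_of_testFunctions hΩ hK f
  have hj : ∀ f, j f =ᵐ[weightMeasure Ω v] f.1.1.fst := fun f => (hmem f).coeFn_toLp
  refine ⟨j, fun f => hv.ae_eq (hj f), ?_⟩
  refine (isCompactOperator_iff_exists_mem_nhds_isCompact_closure_image j).2
    ⟨ball 0 1, ball_mem_nhds 0 zero_lt_one, ?_⟩
  -- Test elements are dense in the open unit ball, so by continuity `j` maps the ball into the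
  -- closure of `j '' B`. It suffices that `j '' B` is totally bounded, since the target is
  -- complete.
  set B := ball (0 : SobolevW0 Ω p) 1 ∩
    {f : SobolevW0 Ω p | (f : SobolevW Ω p) ∈ testElements Ω p} with hB
  have hsub : j '' ball 0 1 ⊆ closure (j '' B) :=
    (image_mono (dense_testElements.open_subset_closure_inter isOpen_ball)).trans
      (image_closure_subset_closure_image j.continuous)
  suffices hT : TotallyBounded (j '' B) from
    (hT.closure.subset hsub).closure.isCompact_of_isClosed isClosed_closure
  choose η hη hηB using fun f : B => f.2.2
  refine Metric.totallyBounded_iff.2 fun ε hε => ?_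
  obtain ⟨t, htf, ht⟩ := hnet hη (fun f => by
    refine (eLpNorm_fderiv_le_norm hΩ _ (hη f) (hηB f)).trans ?_
    exact ENNReal.ofReal_le_one.2 (mem_ball_zero_iff.1 f.2.1).le) (half_pos hε)
  refine ⟨(fun f : B => j f) '' t, htf.image _, ?_⟩
  rintro _ ⟨f, hf, rfl⟩
  obtain ⟨k, hk, hfk⟩ := ht ⟨f, hf⟩
  refine mem_iUnion₂.2 ⟨j k, mem_image_of_mem _ hk, ?_⟩
  have hjη : ∀ g : B, j g =ᵐ[weightMeasure Ω v] η g := fun g =>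
    (hj g).trans (hac.ae_eq (hηB g))
  rw [← eLpNorm_congr_ae ((hjη ⟨f, hf⟩).sub (hjη k)), ← Lp.edist_def, edist_dist,
    ENNReal.ofReal_le_ofReal_iff (half_pos hε).le] at hfk
  exact mem_ball.2 (hfk.trans_lt (half_lt_self hε))

end Sobolev

end ConformalEmbedding

end

/-! ### The choice of exponents and the conclusion. -/

theorem theorem4p8 (Ω : Set ℂ) (hΩo : IsOpen Ω) (hΩs : IsSimplyConnected Ω)
    (hΩb : (frontier Ω).Nonempty) (φ : ℂ → ℂ)
    (hφ : ConformalEmbedding.IsConformalHomeo φ Ω (Metric.ball 0 1))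
    (α₀ : ℝ) (hα₀ : α₀ ∈ Set.Ioo (-2 : ℝ) 0)
    (hB : ConformalEmbedding.InverseBrennan Ω (Set.Ico α₀ (2 / 3)))
    (p : ℝ) [Fact (1 ≤ p)] (hp : p ∈ Set.Ioo ((|α₀| + 2) / (|α₀| + 1)) 2) :
    2 * p / (2 - p) * (|α₀| / (2 + |α₀|)) < p / (2 - p) ∧
    ∀ (r : ℝ) [Fact (1 ≤ r)], r < 2 * p / (2 - p) * (|α₀| / (2 + |α₀|)) →
      ∃ j : ConformalEmbedding.SobolevW0 Ω p →L[ℝ]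
          ConformalEmbedding.WeightedLp Ω (ConformalEmbedding.conformalWeight φ) r,
        ConformalEmbedding.IsEmbeddingOperator Ω (ConformalEmbedding.conformalWeight φ) p r j ∧
        IsCompactOperator j := by
  obtain ⟨hα1, hα2⟩ := hα₀
  obtain ⟨hp1, hp2⟩ := hp
  have hfin := hB _ (hφ.inverse hΩo Metric.isOpen_ball) α₀ ⟨le_rfl, by linarith⟩
  rw [abs_of_neg hα2] at hp1 ⊢
  obtain ⟨a, rfl⟩ : ∃ a, α₀ = -a := ⟨-α₀, (neg_neg _).symm⟩
  simp only [neg_neg] at hp1 ⊢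
  have ha : 0 < a := by linarith
  have ha2 : a < 2 := by linarith
  have hp0 : 1 ≤ p := Fact.out
  have h2p : 0 < 2 - p := by linarith
  have h2a : 0 < 2 + a := by linarith
  rw [div_lt_iff₀ (by linarith)] at hp1
  constructor
  · have e : 2 * p / (2 - p) * (a / (2 + a)) = p / (2 - p) * (2 * a / (2 + a)) := by
      field_simp
    rw [e]
    exact mul_lt_of_lt_one_right (by positivity) ((div_lt_one h2a).2 (by linarith))
  intro r hr hrlt
  have hd : 0 < 2 + a - p := by linarith
  -- The solution of `q(2 - p)/(p - q) = a`. The bound `q ≥ 1` amounts to `p(a + 1) ≥ a + 2`, which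
  -- the lower bound on `p` provides, and `q < p` amounts to `p < 2`.
  set q := a * p / (2 + a - p) with hq
  have hq1 : 1 ≤ q := by rw [hq, le_div_iff₀ hd]; linarith
  have hqp : q < p := by rw [hq, div_lt_iff₀ hd]; nlinarith
  have e1 : -(q * (2 - p) / (p - q)) = -a := by
    have : p - q = p * (2 - p) / (2 + a - p) := by
      rw [hq]; field_simp; ring
    rw [this, hq]
    field_simp
  have e2 : 2 * q / (2 - q) = 2 * p / (2 - p) * (a / (2 + a)) := by
    have : 2 - q = (2 - p) * (2 + a) / (2 + a - p) := by
      rw [hq]; field_simp; ring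
    rw [this, hq]
    field_simp
  rw [← e1] at hfin
  rw [← e2] at hrlt
  have hq2 : q < 2 := hqp.trans hp2
  obtain ⟨K, hK0, hK⟩ := ConformalEmbedding.exists_weighted_sobolev_const hΩo hφ hq1 hqp hq2
    hr.out hrlt hfin
  exact ConformalEmbedding.exists_compact_embeddingOperator hΩo
    (hφ.restrict_absolutelyContinuous_weightMeasure hΩo Metric.isOpen_ball) hK0 hK
    (fun h1 h2 _ h3 =>
      ConformalEmbedding.exists_finite_net_weighted hΩo hφ hq1 hqp hq2 hr.out hrlt hfin h1 h2 h3)
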